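/- Let $d \in \mathbb{N}$, let $\tilde P_1^{(1)}, \tilde P_2^{(1)} \in \mathbb{R}^{d\times d}$ and $\tilde P_c^{(2)} \in \mathbb{R}^{2d\times 2d}$ be (symmetric) positive definite matrices, and let $H = \begin{bmatrix} I_d \\ I_d\end{bmatrix} \in \mathbb{R}^{2d\times d}$. Write $\tilde P_{i}^{(2)}$ ($i=1,2$) for the diagonal $d\times d$ blocks of $\tilde P_c^{(2)}$. For a positive definite $P \in \mathbb{R}^{d\times d}$ let $\mathcal{E}(P) = \{x \in \mathbb{R}^d : x^\top P^{-1} x \le 1\}$ be the associated ellipsoid. The ellipsoid $\mathcal{E}(P)$ is said to tightly circumscribe a set $\mathcal{V}\subseteq\mathbb{R}^d$ if $\mathcal{V} \subseteq \mathcal{E}(P)$ and if, for every positive definite $Q$, $\mathcal{V} \subseteq \mathcal{E}(Q) \subseteq \mathcal{E}(P)$ implies $P = Q$. The set of admissible covariances is $$\mathcal{A}_{\mathrm{ESCI}} = \left\{ P^{(1)} + \tilde P_c^{(2)} \;:\; P^{(1)} \in \mathbb{R}^{2d\times 2d},\ P^{(1)} \succeq 0,\ P^{(1)}_{1,1} =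 \tilde P_1^{(1)},\ P^{(1)}_{2,2} = \tilde P_2^{(1)} \right\},$$ where $P^{(1)}_{i,i}$ are the diagonal $d \times d$ blocks of $P^{(1)}$, and its minimal volume is $$\mathcal{V}(\mathcal{A}_{\mathrm{ESCI}}) = \bigcup_{P \in \mathcal{A}_{\mathrm{ESCI}}} \mathcal{E}\left( (H^\top P^{-1} H)^{-1} \right).$$ For $0 < \omega < 1$ the ESCI bound is $$B_F^{\mathrm{ESCI}}(\omega) = \left( H^\top \left( \begin{bmatrix} \frac{1}{\omega} \tilde P_1^{(1)} & 0 \\ 0 & \frac{1}{1-\omega} \tilde P_2^{(1)} \end{bmatrix} + \tilde P_c^{(2)} \right)^{-1} H \right)^{-1},$$ and it is extended by continuity to $\omega \in [0,1]$, that is, $B_F^{\mathrm{ESCI}}(0) = \tilde P_2^{(1)} + \tilde P_2^{(2)}$ and $B_F^{\mathrm{ESCI}}(1) = \tilde P_1^{(1)} + \tilde P_1^{(2)}$. Theorem. If $B \in \mathbb{R}^{d \times d}$ is positive definite and the ellipsoid $\mathcal{E}(B)$ tightly circumscribes $\mathcal{V}(\mathcal{A}_{\mathrm{ESCI}})$,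 then there exists $\omega_1 \in [0,1]$ such that $B = B_F^{\mathrm{ESCI}}(\omega_1)$. -/

import Mathlib

open Matrix

namespace ESCI

variable {d : ℕ}

/-- The set `E(P) = {x ∈ ℝᵈ | xᵀ P⁻¹ x ≤ 1}`; it is an ellipsoid when `P` is positive definite. -/
def ellipsoid (P : Matrix (Fin d) (Fin d) ℝ) : Set (Fin d → ℝ) :=
  {x | x ⬝ᵥ (P⁻¹ *ᵥ x) ≤ 1}

/-- The ellipsoid `E(P)` (with `P` positive definite) tightly circumscribes the volume `V`:
it contains `V`, and no other ellipsoid lies between `V` and `E(P)`. -/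
structure TightlyCircumscribes (P : Matrix (Fin d) (Fin d) ℝ) (V : Set (Fin d → ℝ)) : Prop where
  posDef : P.PosDef
  subset : V ⊆ ellipsoid P
  minimal : ∀ Q : Matrix (Fin d) (Fin d) ℝ, Q.PosDef →
    V ⊆ ellipsoid Q → ellipsoid Q ⊆ ellipsoid P → P = Q

/-- The centralized observation matrix `H = 1₂ ⊗ I_d`, i.e. two identity blocks stacked. -/
def obs (d : ℕ) : Matrix (Fin d ⊕ Fin d) (Fin d) ℝ := fromRows 1 1

/-- The optimal fused covariance `(Hᵀ P⁻¹ H)⁻¹` for a known centralized covariance `P`. -/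
noncomputable def optFused (P : Matrix (Fin d ⊕ Fin d) (Fin d ⊕ Fin d) ℝ) :
    Matrix (Fin d) (Fin d) ℝ :=
  ((obs d)ᵀ * P⁻¹ * obs d)⁻¹

/-- The minimal volume of a set `A` of admissible centralized covariances: the union of the
ellipsoids of the optimal fused covariances. -/
def minimalVolume (A : Set (Matrix (Fin d ⊕ Fin d) (Fin d ⊕ Fin d) ℝ)) : Set (Fin d → ℝ) :=
  ⋃ P ∈ A, ellipsoid (optFused P)

/-- The admissible covariances for two estimators with split errors: the first components have
known covariances `P₁`, `P₂` and unknown cross-covariance, the second components have the known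
centralized covariance `C` and are uncorrelated with the first ones. -/
def admissible (P₁ P₂ : Matrix (Fin d) (Fin d) ℝ)
    (C : Matrix (Fin d ⊕ Fin d) (Fin d ⊕ Fin d) ℝ) :
    Set (Matrix (Fin d ⊕ Fin d) (Fin d ⊕ Fin d) ℝ) :=
  {P | ∃ S : Matrix (Fin d ⊕ Fin d) (Fin d ⊕ Fin d) ℝ,
    S.PosSemidef ∧ S.toBlocks₁₁ = P₁ ∧ S.toBlocks₂₂ = P₂ ∧ P = S + C}

/-- The centralized bound `diag(ω⁻¹ P₁, (1-ω)⁻¹ P₂) + C`, meaningful for `0 < ω < 1`. -/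
noncomputable def centralBound (P₁ P₂ : Matrix (Fin d) (Fin d) ℝ)
    (C : Matrix (Fin d ⊕ Fin d) (Fin d ⊕ Fin d) ℝ) (ω : ℝ) :
    Matrix (Fin d ⊕ Fin d) (Fin d ⊕ Fin d) ℝ :=
  fromBlocks ((1 / ω) • P₁) 0 0 ((1 / (1 - ω)) • P₂) + C

/-- The fused bound with weights `(ω, 1 - ω)`, for `ω ∈ [0, 1]`. For `0 < ω < 1` it is
`(Hᵀ (centralBound ω)⁻¹ H)⁻¹`. At the endpoints it is the continuous extension: the estimator of
weight zero is excluded, and what remains is the covariance of the other one. The continuity on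
`[0, 1]` is `continuousOn_fusedBound` below. -/
noncomputable def fusedBound (P₁ P₂ : Matrix (Fin d) (Fin d) ℝ)
    (C : Matrix (Fin d ⊕ Fin d) (Fin d ⊕ Fin d) ℝ) (ω : ℝ) : Matrix (Fin d) (Fin d) ℝ :=
  if ω = 0 then P₂ + C.toBlocks₂₂
  else if ω = 1 then P₁ + C.toBlocks₁₁
  else ((obs d)ᵀ * (centralBound P₁ P₂ C ω)⁻¹ * obs d)⁻¹

theorem posDef_toBlocks₁₁ {C : Matrix (Fin d ⊕ Fin d) (Fin d ⊕ Fin d) ℝ} (hC : C.PosDef) :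
    C.toBlocks₁₁.PosDef := hC.submatrix Sum.inl_injective

theorem posDef_toBlocks₂₂ {C : Matrix (Fin d ⊕ Fin d) (Fin d ⊕ Fin d) ℝ} (hC : C.PosDef) :
    C.toBlocks₂₂.PosDef := hC.submatrix Sum.inr_injective

theorem posDef_centralBound {P₁ P₂ : Matrix (Fin d) (Fin d) ℝ}
    {C : Matrix (Fin d ⊕ Fin d) (Fin d ⊕ Fin d) ℝ} (h₁ : P₁.PosDef) (h₂ : P₂.PosDef)
    (hC : C.PosDef) {ω : ℝ} (h0 : 0 < ω) (h1 : ω < 1) : (centralBound P₁ P₂ C ω).PosDef := by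
  have a₁ : ((1 / ω) • P₁).PosDef := h₁.smul (by positivity)
  have a₂ : ((1 / (1 - ω)) • P₂).PosDef := h₂.smul (by have : 0 < 1 - ω := by linarith
                                                       positivity)
  have key : (fromBlocks ((1 / ω) • P₁) 0 0 ((1 / (1 - ω)) • P₂)).PosSemidef := by
    have := a₁.isUnit.invertible
    have := (Matrix.PosDef.fromBlocks₁₁ (A := (1 / ω) • P₁) 0 ((1 / (1 - ω)) • P₂) a₁).2
    simp only [conjTranspose_zero, Matrix.zero_mul, sub_zero] at this
    exact this a₂.posSemidef
  exact hC.posSemidef_add key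

theorem obs_injective : Function.Injective ((obs d) *ᵥ ·) := by
  intro x y h
  have h' : fromRows 1 1 *ᵥ x = (fromRows 1 1 : Matrix (Fin d ⊕ Fin d) (Fin d) ℝ) *ᵥ y := h
  rw [fromRows_mulVec, fromRows_mulVec, one_mulVec, one_mulVec] at h'
  funext i
  exact congrFun h' (Sum.inl i)

theorem continuousOn_inv {n : Type*} [Fintype n] [DecidableEq n] {f : ℝ → Matrix n n ℝ}
    {s : Set ℝ} (hf : ContinuousOn f s) (h : ∀ x ∈ s, IsUnit (f x).det) :
    ContinuousOn (fun x => (f x)⁻¹) s := fun x hx =>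
  ContinuousAt.comp_continuousWithinAt (continuousAt_matrix_inv (f x) (by
    rw [Ring.inverse_eq_inv']
    exact continuousAt_inv₀ (h x hx).ne_zero)) (hf x hx)

theorem continuous_sandwich : Continuous fun p : Matrix (Fin d ⊕ Fin d) (Fin d ⊕ Fin d) ℝ =>
    (obs d)ᵀ * p * obs d :=
  (continuous_const.matrix_mul continuous_id).matrix_mul continuous_const

/-- The fused bound is continuous on `[0, 1]`, so its endpoint values are the limits of the values
in the interior. -/
theorem continuousOn_fusedBound {P₁ P₂ : Matrix (Fin d) (Fin d) ℝ}
    {C : Matrix (Fin d ⊕ Fin d) (Fin d ⊕ Fin d) ℝ} (h₁ : P₁.PosDef) (h₂ : P₂.PosDef)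
    (hC : C.PosDef) : ContinuousOn (fusedBound P₁ P₂ C) (Set.Icc 0 1) := by
  obtain ⟨K, L, M, N, rfl⟩ : ∃ K L M N, C = fromBlocks K L M N :=
    ⟨_, _, _, _, (fromBlocks_toBlocks C).symm⟩
  have hK : (P₁ + K).PosDef := h₁.add (by simpa using posDef_toBlocks₁₁ hC)
  have hN : (P₂ + N).PosDef := h₂.add (by simpa using posDef_toBlocks₂₂ hC)
  let D : ℝ → Matrix (Fin d ⊕ Fin d) (Fin d ⊕ Fin d) ℝ :=
    fun ω => fromBlocks (ω • 1) 0 0 ((1 - ω) • 1)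
  let E : ℝ → Matrix (Fin d ⊕ Fin d) (Fin d ⊕ Fin d) ℝ :=
    fun ω => fromBlocks (P₁ + ω • K) ((1 - ω) • L) (ω • M) (P₂ + (1 - ω) • N)
  have hE : ∀ ω ∈ Set.Ioo (0 : ℝ) 1, E ω = centralBound P₁ P₂ (fromBlocks K L M N) ω * D ω := by
    rintro ω ⟨h0, h1⟩
    have : 1 - ω ≠ 0 := by linarith
    simp only [centralBound, fromBlocks_add, fromBlocks_multiply, D, E]
    congr 1 <;> simp [smul_smul, smul_add, h0.ne', this]
  have hD : ∀ ω ∈ Set.Ioo (0 : ℝ) 1, IsUnit (D ω).det := by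
    rintro ω ⟨h0, h1⟩
    have : 1 - ω ≠ 0 := by linarith
    simp [D, det_fromBlocks_zero₂₁, h0.ne', this]
  have hEu : ∀ ω ∈ Set.Icc (0 : ℝ) 1, IsUnit (E ω).det := by
    rintro ω ⟨h0, h1⟩
    rcases h0.eq_or_lt with rfl | h0
    · simpa [E, det_fromBlocks_zero₂₁] using And.intro h₁.det_pos.ne' hN.det_pos.ne'
    rcases h1.eq_or_lt with rfl | h1
    · simpa [E, det_fromBlocks_zero₁₂] using And.intro hK.det_pos.ne' h₂.det_pos.ne'
    rw [hE ω ⟨h0, h1⟩, det_mul]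
    exact ((isUnit_iff_isUnit_det _).1 (posDef_centralBound h₁ h₂ hC h0 h1).isUnit).mul
      (hD ω ⟨h0, h1⟩)
  have hX0 : (obs d)ᵀ * (D 0 * (E 0)⁻¹) * obs d = (P₂ + N)⁻¹ := by
    have : D 0 = fromBlocks 0 0 0 (P₂ + N)⁻¹ * E 0 := by
      simp [D, E, fromBlocks_multiply, nonsing_inv_mul _ hN.det_pos.ne'.isUnit]
    rw [this, mul_nonsing_inv_cancel_right _ _ (hEu 0 (by simp))]
    simp [obs, transpose_fromRows, fromBlocks_mul_fromRows, Matrix.mul_assoc,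
      fromCols_mul_fromRows]
  have hX1 : (obs d)ᵀ * (D 1 * (E 1)⁻¹) * obs d = (P₁ + K)⁻¹ := by
    have : D 1 = fromBlocks (P₁ + K)⁻¹ 0 0 0 * E 1 := by
      simp [D, E, fromBlocks_multiply, nonsing_inv_mul _ hK.det_pos.ne'.isUnit]
    rw [this, mul_nonsing_inv_cancel_right _ _ (hEu 1 (by simp))]
    simp [obs, transpose_fromRows, fromBlocks_mul_fromRows, Matrix.mul_assoc,
      fromCols_mul_fromRows]
  have hX : ∀ ω ∈ Set.Ioo (0 : ℝ) 1,
      D ω * (E ω)⁻¹ = (centralBound P₁ P₂ (fromBlocks K L M N) ω)⁻¹ := by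
    intro ω hω
    rw [hE ω hω, Matrix.mul_inv_rev, mul_nonsing_inv_cancel_left _ _ (hD ω hω)]
  have hF : ContinuousOn (fun ω => ((obs d)ᵀ * (D ω * (E ω)⁻¹) * obs d)⁻¹) (Set.Icc 0 1) := by
    refine continuousOn_inv ?_ ?_
    · have hDc : Continuous D := by
        refine Continuous.matrix_fromBlocks ?_ ?_ ?_ ?_ <;> fun_prop
      have hEc : Continuous E := by
        refine Continuous.matrix_fromBlocks ?_ ?_ ?_ ?_ <;> fun_prop
      have hEi := continuousOn_inv hEc.continuousOn hEu
      exact continuous_sandwich.comp_continuousOn (hDc.continuousOn.mul hEi)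
    · rintro ω ⟨h0, h1⟩
      rcases h0.eq_or_lt with rfl | h0
      · rw [hX0]
        exact hN.inv.det_pos.ne'.isUnit
      rcases h1.eq_or_lt with rfl | h1
      · rw [hX1]
        exact hK.inv.det_pos.ne'.isUnit
      rw [hX ω ⟨h0, h1⟩]
      have := (posDef_centralBound h₁ h₂ hC h0 h1).inv.conjTranspose_mul_mul_same
        (obs_injective (d := d))
      exact this.det_pos.ne'.isUnit
  refine hF.congr ?_
  rintro ω ⟨h0, h1⟩
  simp only [fusedBound]
  split_ifs with ha hb
  · subst ha
    rw [hX0, nonsing_inv_nonsing_inv _ hN.det_pos.ne'.isUnit, toBlocks_fromBlocks₂₂]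
  · subst hb
    rw [hX1, nonsing_inv_nonsing_inv _ hK.det_pos.ne'.isUnit, toBlocks_fromBlocks₁₁]
  · rw [hX ω ⟨lt_of_le_of_ne h0 (Ne.symm ha), lt_of_le_of_ne h1 hb⟩]

end ESCI

/-! ### Yuan's lemma for two quadratic forms. -/

section QuadraticForms

/-! Put `q₁`, `q₂`, `qC` for the forms of `P₁⁻¹`, `P₂⁻¹`, `C⁻¹`, with `q₁`, `q₂` read on the two
halves of `a`. Over the splittings `a + b = H x`, the minimal volume consists of the `x` for which
`max (q₁ a) (q₂ a) + qC b ≤ 1` has a solution (`mem_minimalVolume_iff`), while the inverse form of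
the bound at `ω` is the minimum of `ω q₁ a + (1 - ω) q₂ a + qC b`. A weighted mean is at most a
maximum, so every bound contains the volume.

Conversely, if `E(B)` contains the volume, then by homogeneity the form of `B⁻¹` at `x` is at most
`max (q₁ a) (q₂ a) + qC (H x - a)` for all `(a, x)`. Thus the maximum of two quadratic forms is
nonnegative, and Yuan's lemma replaces it by a fixed mixture `ω`. Minimizing over `a` puts the
ellipsoid of that bound inside `E(B)`, and tightness forces equality. -/

/-- If a convex combination of two quadratic forms is negative at two vectors, and the first form is
negative at one of them and the second at the other, then both are negative at a common vector. -/
theorem QuadraticMap.exists_both_neg_of_mixture_neg {V : Type*} [AddCommGroup V] [Module ℝ V]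
    (Q R : QuadraticForm ℝ V) {ω : ℝ} (h0 : 0 ≤ ω) (h1 : ω ≤ 1) {x y : V}
    (hx : ω * Q x + (1 - ω) * R x < 0) (hy : ω * Q y + (1 - ω) * R y < 0)
    (hQ : Q x < 0) (hR : R y < 0) : ∃ z, Q z < 0 ∧ R z < 0 := by
  have expand : ∀ (T : QuadraticForm ℝ V) (u v : V) (s t : ℝ),
      T (s • u + t • v) = s * s * T u + t * t * T v + s * t * QuadraticMap.polar T u v := by
    intro T u v s t
    have h : QuadraticMap.polar T (s • u) (t • v) = s • t • QuadraticMap.polar T u v := by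
      rw [QuadraticMap.polar_smul_left, QuadraticMap.polar_smul_right]
    have h' : T (s • u + t • v) = T (s • u) + T (t • v) + QuadraticMap.polar T (s • u) (t • v) := by
      simp [QuadraticMap.polar]
    rw [h', h, QuadraticMap.map_smul, QuadraticMap.map_smul]
    simp only [smul_eq_mul]
    ring
  -- Replacing `y` by `-y` keeps both values and flips the cross term, so the mixture can be kept
  -- negative along the whole segment from `x` to `v`.
  obtain ⟨v, hvQ, hvR, hv⟩ : ∃ v, Q v = Q y ∧ R v = R y ∧
      ω * QuadraticMap.polar Q x v + (1 - ω) * QuadraticMap.polar R x v ≤ 0 := by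
    rcases le_total (ω * QuadraticMap.polar Q x y + (1 - ω) * QuadraticMap.polar R x y) 0 with h | h
    · exact ⟨y, rfl, rfl, h⟩
    · refine ⟨-y, QuadraticMap.map_neg Q y, QuadraticMap.map_neg R y, ?_⟩
      rw [QuadraticMap.polar_neg_right, QuadraticMap.polar_neg_right]
      linarith
  let z : ℝ → V := fun t => (1 - t) • x + t • v
  have hcont : ∀ T : QuadraticForm ℝ V, Continuous fun t => T (z t) := by
    intro T
    simp only [z, expand]
    fun_prop
  have hneg : ∀ t ∈ Set.Icc (0 : ℝ) 1, Q (z t) < 0 ∨ R (z t) < 0 := by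
    rintro t ⟨ht0, ht1⟩
    have hz : ω * Q (z t) + (1 - ω) * R (z t) < 0 := by
      simp only [z, expand, hvQ, hvR]
      have e1 : 0 ≤ (1 - t) * t := mul_nonneg (by linarith) ht0
      have e2 := mul_nonneg e1 (neg_nonneg.2 hv)
      have e3 : 0 < (1 - t) * (1 - t) * -(ω * Q x + (1 - ω) * R x)
          + t * t * -(ω * Q y + (1 - ω) * R y) := by
        rcases ht0.eq_or_lt with rfl | ht
        · linarith
        · exact add_pos_of_nonneg_of_pos
            (mul_nonneg (mul_self_nonneg _) (by linarith)) (mul_pos (mul_pos ht ht) (by linarith))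
      linarith
    by_contra! h
    have := mul_nonneg h0 h.1
    have := mul_nonneg (sub_nonneg.2 h1) h.2
    linarith
  -- Two open sets cover the connected interval and each meets it, so they meet there.
  obtain ⟨t, -, hQt, hRt⟩ := isPreconnected_Icc (a := (0 : ℝ)) (b := 1)
    {t | Q (z t) < 0} {t | R (z t) < 0} (isOpen_lt (hcont Q) continuous_const)
    (isOpen_lt (hcont R) continuous_const) hneg
    ⟨0, by simp, by simpa [z] using hQ⟩ ⟨1, by simp, by simpa [z, hvR] using hR⟩
  exact ⟨z t, hQt, hRt⟩

/-- Yuan's lemma: if the maximum of two quadratic forms is nonnegative, then so is one of their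
convex combinations. -/
theorem QuadraticMap.exists_mixture_nonneg {V : Type*} [AddCommGroup V] [Module ℝ V]
    (Q R : QuadraticForm ℝ V) (h : ∀ x, 0 ≤ Q x ∨ 0 ≤ R x) :
    ∃ ω ∈ Set.Icc (0 : ℝ) 1, ∀ x, 0 ≤ ω * Q x + (1 - ω) * R x := by
  by_contra! hno
  have hopen : ∀ p : V → Prop,
      IsOpen {ω : ℝ | ∃ x, p x ∧ ω * Q x + (1 - ω) * R x < 0} := by
    intro p
    have : {ω : ℝ | ∃ x, p x ∧ ω * Q x + (1 - ω) * R x < 0}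
        = ⋃ x, ⋃ _ : p x, {ω : ℝ | ω * Q x + (1 - ω) * R x < 0} := by
      ext ω
      simp
    rw [this]
    exact isOpen_iUnion fun x => isOpen_iUnion fun _ =>
      isOpen_lt (by fun_prop) continuous_const
  -- The same connectedness argument, now in the weight: the weights are sorted by which form is
  -- negative at a witness. Weight `1` forces `Q`, weight `0` forces `R`.
  obtain ⟨ω, ⟨h0, h1⟩, ⟨x, hx, hx'⟩, y, hy, hy'⟩ := isPreconnected_Icc (a := (0 : ℝ)) (b := 1)
    _ _ (hopen fun x => Q x < 0) (hopen fun x => R x < 0)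
    (by
      rintro ω ⟨h0, h1⟩
      obtain ⟨x, hx⟩ := hno ω ⟨h0, h1⟩
      by_cases hQ : Q x < 0
      · exact Or.inl ⟨x, hQ, hx⟩
      · refine Or.inr ⟨x, ?_, hx⟩
        by_contra! hR
        have := mul_nonneg h0 (not_lt.1 hQ)
        have := mul_nonneg (sub_nonneg.2 h1) hR
        linarith)
    (by
      obtain ⟨x, hx⟩ := hno 1 (by simp)
      exact ⟨1, by simp, x, by simpa using hx, hx⟩)
    (by
      obtain ⟨x, hx⟩ := hno 0 (by simp)
      exact ⟨0, by simp, x, by simpa using hx, hx⟩)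
  obtain ⟨z, hzQ, hzR⟩ := exists_both_neg_of_mixture_neg Q R h0 h1 hx' hy' hx hy
  rcases h z with hz | hz <;> linarith

end QuadraticForms

/-! ### Inequalities for positive definite matrices and their inverses. -/

namespace ESCI

section Matrices

variable {m n : Type*} [Fintype m] [Fintype n]

theorem dotProduct_mulVec_comm {M : Matrix n n ℝ} (hM : M.IsHermitian) (v w : n → ℝ) :
    v ⬝ᵥ (M *ᵥ w) = w ⬝ᵥ (M *ᵥ v) := by
  have hT : Mᵀ = M := by simpa using hM.eq
  rw [dotProduct_mulVec, ← mulVec_transpose, hT, dotProduct_comm]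

theorem nonneg_of_posSemidef {M : Matrix n n ℝ} (hM : M.PosSemidef) (v : n → ℝ) :
    0 ≤ v ⬝ᵥ (M *ᵥ v) := by
  simpa using hM.dotProduct_mulVec_nonneg v

theorem two_mul_dotProduct_mulVec_le {M : Matrix n n ℝ} (hM : M.PosSemidef) (v w : n → ℝ) :
    2 * (v ⬝ᵥ (M *ᵥ w)) ≤ v ⬝ᵥ (M *ᵥ v) + w ⬝ᵥ (M *ᵥ w) := by
  have h := nonneg_of_posSemidef hM (v - w)
  simp only [mulVec_sub, dotProduct_sub, sub_dotProduct] at h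
  linarith [dotProduct_mulVec_comm hM.1 v w]

/-- Cauchy–Schwarz for the form of a positive semidefinite matrix. -/
theorem dotProduct_mulVec_sq_le {M : Matrix n n ℝ} (hM : M.PosSemidef) (v w : n → ℝ) :
    (v ⬝ᵥ (M *ᵥ w)) ^ 2 ≤ (v ⬝ᵥ (M *ᵥ v)) * (w ⬝ᵥ (M *ᵥ w)) := by
  have h : ∀ t : ℝ, 0 ≤ (w ⬝ᵥ (M *ᵥ w)) * (t * t) + (2 * (v ⬝ᵥ (M *ᵥ w))) * t
      + v ⬝ᵥ (M *ᵥ v) := by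
    intro t
    have h := nonneg_of_posSemidef hM (v + t • w)
    simp only [mulVec_add, dotProduct_add, add_dotProduct, mulVec_smul, dotProduct_smul,
      smul_dotProduct, smul_eq_mul] at h
    rw [dotProduct_mulVec_comm hM.1 w v] at h
    linarith
  have := discrim_le_zero h
  rw [discrim] at this
  linarith

variable [DecidableEq n]

theorem mulVec_inv_mulVec {M : Matrix n n ℝ} (hM : M.PosDef) (v : n → ℝ) :
    M *ᵥ (M⁻¹ *ᵥ v) = v := by
  rw [mulVec_mulVec, mul_nonsing_inv _ hM.det_pos.ne'.isUnit, one_mulVec]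

theorem inv_mulVec_mulVec {M : Matrix n n ℝ} (hM : M.PosDef) (v : n → ℝ) :
    M⁻¹ *ᵥ (M *ᵥ v) = v := by
  rw [mulVec_mulVec, nonsing_inv_mul _ hM.det_pos.ne'.isUnit, one_mulVec]

/-- Fenchel–Young: the form of `M` is nonnegative at `w - M⁻¹ b`. -/
theorem two_mul_dotProduct_le {M : Matrix n n ℝ} (hM : M.PosDef) (w b : n → ℝ) :
    2 * (w ⬝ᵥ b) ≤ b ⬝ᵥ (M⁻¹ *ᵥ b) + w ⬝ᵥ (M *ᵥ w) := by
  have h := two_mul_dotProduct_mulVec_le hM.posSemidef w (M⁻¹ *ᵥ b)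
  rw [mulVec_inv_mulVec hM, dotProduct_comm (M⁻¹ *ᵥ b)] at h
  linarith

theorem dotProduct_sq_le {M : Matrix n n ℝ} (hM : M.PosDef) (w b : n → ℝ) :
    (w ⬝ᵥ b) ^ 2 ≤ (b ⬝ᵥ (M⁻¹ *ᵥ b)) * (w ⬝ᵥ (M *ᵥ w)) := by
  have h := dotProduct_mulVec_sq_le hM.posSemidef w (M⁻¹ *ᵥ b)
  rw [mulVec_inv_mulVec hM, dotProduct_comm (M⁻¹ *ᵥ b)] at h
  linarith

theorem inv_form_nonneg {M : Matrix n n ℝ} (hM : M.PosDef) (v : n → ℝ) :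
    0 ≤ v ⬝ᵥ (M⁻¹ *ᵥ v) :=
  nonneg_of_posSemidef hM.inv.posSemidef v

/-- The upper bound in `zᵀ (D + C)⁻¹ z = min {aᵀ D⁻¹ a + bᵀ C⁻¹ b | a + b = z}`. -/
theorem inv_add_form_le {D C : Matrix n n ℝ} (hD : D.PosDef) (hC : C.PosDef) (a b : n → ℝ) :
    (a + b) ⬝ᵥ ((D + C)⁻¹ *ᵥ (a + b)) ≤ a ⬝ᵥ (D⁻¹ *ᵥ a) + b ⬝ᵥ (C⁻¹ *ᵥ b) := by
  set w := (D + C)⁻¹ *ᵥ (a + b) with hw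
  have hz : (D + C) *ᵥ w = a + b := mulVec_inv_mulVec (hD.add hC) _
  -- The optimal dual vector `w` serves in both Young inequalities; their sum is the claim.
  have h1 := two_mul_dotProduct_le hD w a
  have h2 := two_mul_dotProduct_le hC w b
  have h3 : w ⬝ᵥ (a + b) = w ⬝ᵥ (D *ᵥ w) + w ⬝ᵥ (C *ᵥ w) := by
    rw [← hz, add_mulVec, dotProduct_add]
  rw [dotProduct_comm, h3]
  rw [dotProduct_add] at h3
  linarith

/-- The minimum in `zᵀ (D + C)⁻¹ z = min {aᵀ D⁻¹ a + bᵀ C⁻¹ b | a + b = z}` is attained. -/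
theorem exists_inv_add_form_eq {D C : Matrix n n ℝ} (hD : D.PosDef) (hC : C.PosDef) (z : n → ℝ) :
    ∃ a b, a + b = z ∧
      a ⬝ᵥ (D⁻¹ *ᵥ a) + b ⬝ᵥ (C⁻¹ *ᵥ b) = z ⬝ᵥ ((D + C)⁻¹ *ᵥ z) := by
  set w := (D + C)⁻¹ *ᵥ z with hw
  have hz : (D + C) *ᵥ w = z := mulVec_inv_mulVec (hD.add hC) _
  rw [add_mulVec] at hz
  refine ⟨D *ᵥ w, C *ᵥ w, hz, ?_⟩
  rw [inv_mulVec_mulVec hD, inv_mulVec_mulVec hC, ← add_dotProduct, hz]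

/-- Extension of a vector along `e`, given by the columns `e j` of the identity matrix. -/
def extendVec (e : m → n) (u : m → ℝ) : n → ℝ := (1 : Matrix n n ℝ).submatrix id e *ᵥ u

theorem extendVec_dotProduct (e : m → n) (u : m → ℝ) (v : n → ℝ) :
    extendVec e u ⬝ᵥ v = u ⬝ᵥ (v ∘ e) := by
  rw [extendVec, dotProduct_comm, dotProduct_mulVec, dotProduct_comm]
  congr 1
  ext i
  simp [vecMul, dotProduct, Matrix.one_apply]

theorem mulVec_extendVec_comp (S : Matrix n n ℝ) (e : m → n) (u : m → ℝ) :
    (S *ᵥ extendVec e u) ∘ e = S.submatrix e e *ᵥ u := by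
  rw [extendVec, mulVec_mulVec]
  ext i
  simp [mulVec, dotProduct, Matrix.mul_apply, Matrix.one_apply]

variable [DecidableEq m]

/-- If `S` has the positive definite diagonal block `P`, selected by `e`, then
`aᵀ P⁻¹ a ≤ wᵀ S w` for the corresponding part `a` of `S w`. -/
theorem inv_form_block_le {S : Matrix n n ℝ} (hS : S.PosSemidef) {P : Matrix m m ℝ}
    (hP : P.PosDef) (e : m → n) (he : S.submatrix e e = P) (w : n → ℝ) :
    ((S *ᵥ w) ∘ e) ⬝ᵥ (P⁻¹ *ᵥ ((S *ᵥ w) ∘ e)) ≤ w ⬝ᵥ (S *ᵥ w) := by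
  set a := (S *ᵥ w) ∘ e with ha
  -- Both the cross term and the form of `S` at the extended vector equal `aᵀ P⁻¹ a`. No inverse of
  -- `S` is involved, since `S` may be singular.
  have h := two_mul_dotProduct_mulVec_le hS (extendVec e (P⁻¹ *ᵥ a)) w
  rw [extendVec_dotProduct, extendVec_dotProduct, mulVec_extendVec_comp, he,
    mulVec_inv_mulVec hP, ← ha] at h
  rw [dotProduct_comm]
  linarith

/-- With the next lemma: minimizing `bᵀ C⁻¹ b` with one block of `b` prescribed gives the inverse
form of the diagonal block. This handles the endpoint weights. -/
theorem inv_form_comp_le {C : Matrix n n ℝ} (hC : C.PosDef) {K : Matrix m m ℝ} (hK : K.PosDef)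
    (e : m → n) (he : C.submatrix e e = K) (b : n → ℝ) :
    (b ∘ e) ⬝ᵥ (K⁻¹ *ᵥ (b ∘ e)) ≤ b ⬝ᵥ (C⁻¹ *ᵥ b) := by
  have h := inv_form_block_le hC.posSemidef hK e he (C⁻¹ *ᵥ b)
  rwa [mulVec_inv_mulVec hC, dotProduct_comm (C⁻¹ *ᵥ b)] at h

theorem exists_inv_form_comp_eq {C : Matrix n n ℝ} (hC : C.PosDef) {K : Matrix m m ℝ}
    (hK : K.PosDef) (e : m → n) (he : C.submatrix e e = K) (c : m → ℝ) :
    ∃ b, b ∘ e = c ∧ b ⬝ᵥ (C⁻¹ *ᵥ b) = c ⬝ᵥ (K⁻¹ *ᵥ c) := by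
  have h : (C *ᵥ extendVec e (K⁻¹ *ᵥ c)) ∘ e = c := by
    rw [mulVec_extendVec_comp, he, mulVec_inv_mulVec hK]
  refine ⟨C *ᵥ extendVec e (K⁻¹ *ᵥ c), h, ?_⟩
  rw [inv_mulVec_mulVec hC, dotProduct_comm, extendVec_dotProduct, h, dotProduct_comm]

/-- By Cauchy–Schwarz, `(y ⬝ᵥ a) ^ 2 ≤ s * yᵀ P y`. For `s = 0` the convention `s⁻¹ = 0` leaves `P`
itself. -/
theorem posSemidef_smul_sub_vecMulVec {P : Matrix n n ℝ} (hP : P.PosDef) {a : n → ℝ} {s : ℝ}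
    (ha : a ⬝ᵥ (P⁻¹ *ᵥ a) ≤ s) : (P - s⁻¹ • vecMulVec a a).PosSemidef := by
  have hs : 0 ≤ s := (inv_form_nonneg hP a).trans ha
  refine .of_dotProduct_mulVec_nonneg (hP.1.sub ?_) fun y => ?_
  · ext i j
    simp [vecMulVec_apply, mul_comm]
  · have h1 := dotProduct_sq_le hP y a
    have h2 := nonneg_of_posSemidef hP.posSemidef y
    have h3 : s⁻¹ * (y ⬝ᵥ a) ^ 2 ≤ y ⬝ᵥ (P *ᵥ y) := by
      rcases hs.eq_or_lt with rfl | hs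
      · simpa using h2
      · rw [inv_mul_le_iff₀ hs]
        exact h1.trans (mul_le_mul_of_nonneg_right ha h2)
    have h4 : star y ⬝ᵥ ((P - s⁻¹ • vecMulVec a a) *ᵥ y)
        = y ⬝ᵥ (P *ᵥ y) - s⁻¹ * (y ⬝ᵥ a) ^ 2 := by
      rw [star_trivial, sub_mulVec, smul_mulVec, vecMulVec_mulVec, dotProduct_sub, dotProduct_smul,
        op_smul_eq_smul, dotProduct_smul, dotProduct_comm a y, smul_eq_mul, smul_eq_mul, sq]
    rw [h4]
    linarith

end Matrices

/-! ### The minimal volume, the fused bounds, and their comparison. -/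

section Fusion

variable {d : ℕ} {P₁ P₂ : Matrix (Fin d) (Fin d) ℝ} {C : Matrix (Fin d ⊕ Fin d) (Fin d ⊕ Fin d) ℝ}

theorem obs_mulVec (x : Fin d → ℝ) : obs d *ᵥ x = Sum.elim x x := by
  simp [obs, fromRows_mulVec]

theorem posDef_sandwich {P : Matrix (Fin d ⊕ Fin d) (Fin d ⊕ Fin d) ℝ} (hP : P.PosDef) :
    ((obs d)ᵀ * P⁻¹ * obs d).PosDef := by
  simpa using hP.inv.conjTranspose_mul_mul_same (obs_injective (d := d))

theorem inv_sandwich_form {P : Matrix (Fin d ⊕ Fin d) (Fin d ⊕ Fin d) ℝ} (hP : P.PosDef)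
    (x : Fin d → ℝ) : x ⬝ᵥ (((obs d)ᵀ * P⁻¹ * obs d)⁻¹⁻¹ *ᵥ x)
      = Sum.elim x x ⬝ᵥ (P⁻¹ *ᵥ Sum.elim x x) := by
  rw [nonsing_inv_nonsing_inv _ (posDef_sandwich hP).det_pos.ne'.isUnit, ← mulVec_mulVec,
    ← mulVec_mulVec, obs_mulVec, dotProduct_mulVec x, vecMul_transpose, obs_mulVec]

theorem posSemidef_fromBlocks_diagonal {M N : Matrix (Fin d) (Fin d) ℝ} (hM : M.PosSemidef)
    (hN : N.PosSemidef) : (fromBlocks M 0 0 N).PosSemidef := by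
  refine .of_dotProduct_mulVec_nonneg ?_ fun y => ?_
  · rw [Matrix.IsHermitian, fromBlocks_conjTranspose, hM.1.eq, hN.1.eq]
    simp
  · rw [fromBlocks_mulVec, star_trivial, ← Sum.elim_comp_inl_inr y, sumElim_dotProduct_sumElim]
    simpa using add_nonneg (nonneg_of_posSemidef hM (y ∘ Sum.inl))
      (nonneg_of_posSemidef hN (y ∘ Sum.inr))

/-- An admissible `S` yields the split `S w`, `C w` with `w = (S + C)⁻¹ H x`, and `wᵀ S w` dominates
both block forms. Conversely, a split with maximum `s` is realized by `S = s⁻¹ a aᵀ + T`, where the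
block diagonal `T ⪰ 0` restores the prescribed diagonal blocks. -/
theorem mem_minimalVolume_iff (h₁ : P₁.PosDef) (h₂ : P₂.PosDef) (hC : C.PosDef)
    (x : Fin d → ℝ) : x ∈ minimalVolume (admissible P₁ P₂ C) ↔
      ∃ a b, a + b = Sum.elim x x ∧
        max ((a ∘ Sum.inl) ⬝ᵥ (P₁⁻¹ *ᵥ (a ∘ Sum.inl))) ((a ∘ Sum.inr) ⬝ᵥ (P₂⁻¹ *ᵥ (a ∘ Sum.inr)))
          + b ⬝ᵥ (C⁻¹ *ᵥ b) ≤ 1 := by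
  simp only [minimalVolume, admissible, Set.mem_iUnion, Set.mem_ofPred_eq, exists_prop]
  constructor
  · rintro ⟨_, ⟨S, hS, hS₁, hS₂, rfl⟩, hx⟩
    have hP : (S + C).PosDef := hC.posSemidef_add hS
    rw [ellipsoid, Set.mem_ofPred_eq, optFused, inv_sandwich_form hP] at hx
    set w := (S + C)⁻¹ *ᵥ Sum.elim x x with hw
    have hz : S *ᵥ w + C *ᵥ w = Sum.elim x x := by
      rw [← add_mulVec, mulVec_inv_mulVec hP]
    refine ⟨S *ᵥ w, C *ᵥ w, hz, ?_⟩
    have e1 := inv_form_block_le hS h₁ Sum.inl hS₁ w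
    have e2 := inv_form_block_le hS h₂ Sum.inr hS₂ w
    rw [inv_mulVec_mulVec hC, dotProduct_comm (C *ᵥ w)]
    rw [← hz, add_dotProduct, dotProduct_comm _ w, dotProduct_comm _ w] at hx
    exact (add_le_add_left (max_le e1 e2) _).trans hx
  · rintro ⟨a, b, hab, h⟩
    set s := max ((a ∘ Sum.inl) ⬝ᵥ (P₁⁻¹ *ᵥ (a ∘ Sum.inl)))
      ((a ∘ Sum.inr) ⬝ᵥ (P₂⁻¹ *ᵥ (a ∘ Sum.inr))) with hs
    have hs₁ : (a ∘ Sum.inl) ⬝ᵥ (P₁⁻¹ *ᵥ (a ∘ Sum.inl)) ≤ s := le_max_left _ _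
    have hs₂ : (a ∘ Sum.inr) ⬝ᵥ (P₂⁻¹ *ᵥ (a ∘ Sum.inr)) ≤ s := le_max_right _ _
    have hs0 : 0 ≤ s := (inv_form_nonneg h₁ _).trans hs₁
    -- Needed in the degenerate case, where `s⁻¹ = 0` removes the rank-one term.
    have ha0 : s = 0 → a = 0 := by
      intro h0
      rw [h0] at hs₁ hs₂
      have z₁ : a ∘ Sum.inl = 0 := by
        by_contra hne
        have := h₁.inv.dotProduct_mulVec_pos hne
        rw [star_trivial] at this
        linarith
      have z₂ : a ∘ Sum.inr = 0 := by
        by_contra hne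
        have := h₂.inv.dotProduct_mulVec_pos hne
        rw [star_trivial] at this
        linarith
      rw [← Sum.elim_comp_inl_inr a, z₁, z₂]
      ext (i | i) <;> rfl
    set T := fromBlocks (P₁ - s⁻¹ • vecMulVec (a ∘ Sum.inl) (a ∘ Sum.inl)) 0 0
      (P₂ - s⁻¹ • vecMulVec (a ∘ Sum.inr) (a ∘ Sum.inr)) with hT
    have hTpos : T.PosSemidef := posSemidef_fromBlocks_diagonal
      (posSemidef_smul_sub_vecMulVec h₁ hs₁) (posSemidef_smul_sub_vecMulVec h₂ hs₂)
    have hApos : (s⁻¹ • vecMulVec a a).PosSemidef := by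
      have := posSemidef_vecMulVec_self_star a
      rw [star_trivial] at this
      exact this.smul (inv_nonneg.2 hs0)
    have hS := hTpos.add hApos
    have hP : (T + s⁻¹ • vecMulVec a a + C).PosDef := hC.posSemidef_add hS
    refine ⟨_, ⟨T + s⁻¹ • vecMulVec a a, hS, ?_, ?_, rfl⟩, ?_⟩
    · ext i j
      simp [hT, toBlocks₁₁, vecMulVec_apply]
    · ext i j
      simp [hT, toBlocks₂₂, vecMulVec_apply]
    rw [ellipsoid, Set.mem_ofPred_eq, optFused, inv_sandwich_form hP, ← hab]
    set w := (T + s⁻¹ • vecMulVec a a + C)⁻¹ *ᵥ (a + b) with hw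
    have hz := mulVec_inv_mulVec hP (a + b)
    rw [← hw] at hz
    have e0 : w ⬝ᵥ (a + b) = w ⬝ᵥ (T *ᵥ w) + s⁻¹ * (w ⬝ᵥ a) ^ 2 + w ⬝ᵥ (C *ᵥ w) := by
      rw [← hz, add_mulVec, add_mulVec, smul_mulVec, vecMulVec_mulVec, op_smul_eq_smul,
        dotProduct_add, dotProduct_add, dotProduct_smul, dotProduct_smul, smul_eq_mul, smul_eq_mul,
        dotProduct_comm a w, sq]
    have e1 := two_mul_dotProduct_le hC w b
    have e2 := nonneg_of_posSemidef hTpos w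
    have e3 : 2 * (w ⬝ᵥ a) ≤ s + s⁻¹ * (w ⬝ᵥ a) ^ 2 := by
      rcases hs0.eq_or_lt with h0 | h0
      · simp [ha0 h0.symm, ← h0]
      · have : 0 ≤ s⁻¹ * (s - w ⬝ᵥ a) ^ 2 := by positivity
        have e : s⁻¹ * (s - w ⬝ᵥ a) ^ 2 = s - 2 * (w ⬝ᵥ a) + s⁻¹ * (w ⬝ᵥ a) ^ 2 := by
          field_simp
          ring
        linarith
    have e4 := dotProduct_add w a b
    rw [dotProduct_comm]
    -- With `v = w ⬝ᵥ (a + b)`, the bounds add up to `2 v ≤ s + bᵀ C⁻¹ b + v ≤ 1 + v`.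
    linarith

theorem posDef_fusedBound (h₁ : P₁.PosDef) (h₂ : P₂.PosDef) (hC : C.PosDef) {ω : ℝ}
    (hω : ω ∈ Set.Icc (0 : ℝ) 1) : (fusedBound P₁ P₂ C ω).PosDef := by
  rw [fusedBound]
  split_ifs with h0 h1
  · exact h₂.add (posDef_toBlocks₂₂ hC)
  · exact h₁.add (posDef_toBlocks₁₁ hC)
  · exact (posDef_sandwich (posDef_centralBound h₁ h₂ hC (lt_of_le_of_ne hω.1 (Ne.symm h0))
      (lt_of_le_of_ne hω.2 h1))).inv

theorem posDef_weighted_blocks (h₁ : P₁.PosDef) (h₂ : P₂.PosDef) {ω : ℝ} (h0 : 0 < ω)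
    (h1 : ω < 1) : (fromBlocks ((1 / ω) • P₁) 0 0 ((1 / (1 - ω)) • P₂)).PosDef := by
  have h1' : 0 < 1 - ω := sub_pos.2 h1
  refine (posSemidef_fromBlocks_diagonal (h₁.smul (one_div_pos.2 h0)).posSemidef
    (h₂.smul (one_div_pos.2 h1')).posSemidef).posDef_iff_isUnit.2 ?_
  rw [isUnit_iff_isUnit_det, det_fromBlocks_zero₂₁]
  exact ((h₁.smul (one_div_pos.2 h0)).det_pos.ne'.isUnit).mul
    (h₂.smul (one_div_pos.2 h1')).det_pos.ne'.isUnit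

theorem weighted_blocks_inv_form (h₁ : P₁.PosDef) (h₂ : P₂.PosDef) {ω : ℝ} (h0 : 0 < ω)
    (h1 : ω < 1) (a : Fin d ⊕ Fin d → ℝ) :
    a ⬝ᵥ ((fromBlocks ((1 / ω) • P₁) 0 0 ((1 / (1 - ω)) • P₂))⁻¹ *ᵥ a)
      = ω * ((a ∘ Sum.inl) ⬝ᵥ (P₁⁻¹ *ᵥ (a ∘ Sum.inl)))
        + (1 - ω) * ((a ∘ Sum.inr) ⬝ᵥ (P₂⁻¹ *ᵥ (a ∘ Sum.inr))) := by
  have h1' : 1 - ω ≠ 0 := by linarith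
  have hinv : (fromBlocks ((1 / ω) • P₁) 0 0 ((1 / (1 - ω)) • P₂))⁻¹
      = fromBlocks (ω • P₁⁻¹) 0 0 ((1 - ω) • P₂⁻¹) := by
    refine inv_eq_right_inv ?_
    simp [fromBlocks_multiply, smul_smul, h0.ne', h1', mul_nonsing_inv _ h₁.det_pos.ne'.isUnit,
      mul_nonsing_inv _ h₂.det_pos.ne'.isUnit]
  have hdot : ∀ u v, a ⬝ᵥ Sum.elim u v = (a ∘ Sum.inl) ⬝ᵥ u + (a ∘ Sum.inr) ⬝ᵥ v := by
    intro u v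
    rw [← sumElim_dotProduct_sumElim, Sum.elim_comp_inl_inr]
  rw [hinv, fromBlocks_mulVec, hdot]
  simp [smul_mulVec]

/-- One half of the variational formula for the bound; attainment is the next lemma. In the interior
it is the formula for `(D + C)⁻¹` with `D` the weighted block diagonal; at an endpoint only one
block of the split is constrained. -/
theorem fusedBound_inv_form_le (h₁ : P₁.PosDef) (h₂ : P₂.PosDef) (hC : C.PosDef) {ω : ℝ}
    (hω : ω ∈ Set.Icc (0 : ℝ) 1) {x : Fin d → ℝ} {a b : Fin d ⊕ Fin d → ℝ}
    (hab : a + b = Sum.elim x x) :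
    x ⬝ᵥ ((fusedBound P₁ P₂ C ω)⁻¹ *ᵥ x)
      ≤ ω * ((a ∘ Sum.inl) ⬝ᵥ (P₁⁻¹ *ᵥ (a ∘ Sum.inl)))
        + (1 - ω) * ((a ∘ Sum.inr) ⬝ᵥ (P₂⁻¹ *ᵥ (a ∘ Sum.inr))) + b ⬝ᵥ (C⁻¹ *ᵥ b) := by
  rw [fusedBound]
  split_ifs with h0 h1
  · have hx : a ∘ Sum.inr + b ∘ Sum.inr = x := congrArg (· ∘ Sum.inr) hab
    have e1 := inv_add_form_le h₂ (posDef_toBlocks₂₂ hC) (a ∘ Sum.inr) (b ∘ Sum.inr)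
    have e2 := inv_form_comp_le hC (posDef_toBlocks₂₂ hC) Sum.inr rfl b
    rw [hx] at e1
    rw [h0]
    linarith
  · have hx : a ∘ Sum.inl + b ∘ Sum.inl = x := congrArg (· ∘ Sum.inl) hab
    have e1 := inv_add_form_le h₁ (posDef_toBlocks₁₁ hC) (a ∘ Sum.inl) (b ∘ Sum.inl)
    have e2 := inv_form_comp_le hC (posDef_toBlocks₁₁ hC) Sum.inl rfl b
    rw [hx] at e1
    rw [h1]
    linarith
  · have p0 := lt_of_le_of_ne hω.1 (Ne.symm h0)
    have p1 := lt_of_le_of_ne hω.2 h1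
    rw [inv_sandwich_form (posDef_centralBound h₁ h₂ hC p0 p1), ← hab, centralBound,
      ← weighted_blocks_inv_form h₁ h₂ p0 p1]
    exact inv_add_form_le (posDef_weighted_blocks h₁ h₂ p0 p1) hC a b

theorem exists_fusedBound_inv_form_eq (h₁ : P₁.PosDef) (h₂ : P₂.PosDef) (hC : C.PosDef) {ω : ℝ}
    (hω : ω ∈ Set.Icc (0 : ℝ) 1) (x : Fin d → ℝ) :
    ∃ a b, a + b = Sum.elim x x ∧
      ω * ((a ∘ Sum.inl) ⬝ᵥ (P₁⁻¹ *ᵥ (a ∘ Sum.inl)))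
        + (1 - ω) * ((a ∘ Sum.inr) ⬝ᵥ (P₂⁻¹ *ᵥ (a ∘ Sum.inr))) + b ⬝ᵥ (C⁻¹ *ᵥ b)
      = x ⬝ᵥ ((fusedBound P₁ P₂ C ω)⁻¹ *ᵥ x) := by
  rw [fusedBound]
  split_ifs with h0 h1
  · obtain ⟨a, c, hac, e⟩ := exists_inv_add_form_eq h₂ (posDef_toBlocks₂₂ hC) x
    obtain ⟨b, hb, e'⟩ := exists_inv_form_comp_eq hC (posDef_toBlocks₂₂ hC) Sum.inr rfl c
    -- The first block of `a` is whatever remains: its weight is zero.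
    refine ⟨Sum.elim x x - b, b, sub_add_cancel _ _, ?_⟩
    have ha : (Sum.elim x x - b) ∘ Sum.inr = a := by
      rw [← add_sub_cancel_right a c, hac, ← hb]
      rfl
    rw [ha, e', ← e, h0]
    ring
  · obtain ⟨a, c, hac, e⟩ := exists_inv_add_form_eq h₁ (posDef_toBlocks₁₁ hC) x
    obtain ⟨b, hb, e'⟩ := exists_inv_form_comp_eq hC (posDef_toBlocks₁₁ hC) Sum.inl rfl c
    refine ⟨Sum.elim x x - b, b, sub_add_cancel _ _, ?_⟩
    have ha : (Sum.elim x x - b) ∘ Sum.inl = a := by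
      rw [← add_sub_cancel_right a c, hac, ← hb]
      rfl
    rw [ha, e', ← e, h1]
    ring
  · have p0 := lt_of_le_of_ne hω.1 (Ne.symm h0)
    have p1 := lt_of_le_of_ne hω.2 h1
    obtain ⟨a, b, hab, e⟩ :=
      exists_inv_add_form_eq (posDef_weighted_blocks h₁ h₂ p0 p1) hC (Sum.elim x x)
    refine ⟨a, b, hab, ?_⟩
    rw [inv_sandwich_form (posDef_centralBound h₁ h₂ hC p0 p1), centralBound, ← e,
      weighted_blocks_inv_form h₁ h₂ p0 p1]

theorem minimalVolume_subset_ellipsoid_fusedBound (h₁ : P₁.PosDef) (h₂ : P₂.PosDef)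
    (hC : C.PosDef) {ω : ℝ} (hω : ω ∈ Set.Icc (0 : ℝ) 1) :
    minimalVolume (admissible P₁ P₂ C) ⊆ ellipsoid (fusedBound P₁ P₂ C ω) := by
  intro x hx
  obtain ⟨a, b, hab, h⟩ := (mem_minimalVolume_iff h₁ h₂ hC x).1 hx
  have e1 := fusedBound_inv_form_le h₁ h₂ hC hω hab
  have e2 := mul_le_mul_of_nonneg_left (le_max_left
    ((a ∘ Sum.inl) ⬝ᵥ (P₁⁻¹ *ᵥ (a ∘ Sum.inl))) ((a ∘ Sum.inr) ⬝ᵥ (P₂⁻¹ *ᵥ (a ∘ Sum.inr)))) hω.1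
  have e3 := mul_le_mul_of_nonneg_left (le_max_right
    ((a ∘ Sum.inl) ⬝ᵥ (P₁⁻¹ *ᵥ (a ∘ Sum.inl))) ((a ∘ Sum.inr) ⬝ᵥ (P₂⁻¹ *ᵥ (a ∘ Sum.inr))))
    (sub_nonneg.2 hω.2)
  rw [ellipsoid, Set.mem_ofPred_eq]
  linarith

/-- The quadratic form `v ↦ vᵀ M v`. -/
noncomputable def matrixForm {n : Type*} [Fintype n] [DecidableEq n] (M : Matrix n n ℝ) :
    QuadraticForm ℝ (n → ℝ) := M.toQuadraticForm'

theorem matrixForm_apply {n : Type*} [Fintype n] [DecidableEq n] (M : Matrix n n ℝ)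
    (v : n → ℝ) : matrixForm M v = v ⬝ᵥ (M *ᵥ v) := by
  rw [matrixForm, Matrix.toQuadraticForm', LinearMap.BilinMap.toQuadraticMap_apply,
    toLinearMap₂'_apply']

/-- An inequality between quadratic forms which holds on the unit sublevel set of the larger one
holds everywhere. -/
theorem le_of_sublevel_le {V : Type*} [AddCommGroup V] [Module ℝ V] {q : V → ℝ} {F : V → ℝ}
    (hq : ∀ (t : ℝ) v, q (t • v) = t * t * q v) (hF : ∀ (t : ℝ) v, F (t • v) = t * t * F v)
    (hF0 : ∀ v, 0 ≤ F v) (h : ∀ v, F v ≤ 1 → q v ≤ 1) (v : V) : q v ≤ F v := by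
  by_contra! hlt
  -- Dividing `v` by `√r` puts `F` below `1` and `q` above it; an intermediate `r` stays positive
  -- even if `F v = 0`.
  obtain ⟨r, hr, hr'⟩ := exists_between hlt
  have hr0 : 0 < r := (hF0 v).trans_lt hr
  have ht : (√r)⁻¹ * (√r)⁻¹ = r⁻¹ := by
    rw [← mul_inv, Real.mul_self_sqrt hr0.le]
  have := h ((√r)⁻¹ • v) (by
    rw [hF, ht, inv_mul_le_iff₀ hr0]
    linarith)
  rw [hq, ht, inv_mul_le_iff₀ hr0] at this
  linarith

theorem exists_ellipsoid_fusedBound_subset (h₁ : P₁.PosDef) (h₂ : P₂.PosDef) (hC : C.PosDef)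
    {B : Matrix (Fin d) (Fin d) ℝ}
    (hB : minimalVolume (admissible P₁ P₂ C) ⊆ ellipsoid B) :
    ∃ ω ∈ Set.Icc (0 : ℝ) 1, ellipsoid (fusedBound P₁ P₂ C ω) ⊆ ellipsoid B := by
  -- Pairs `(a, x)`, with `b = H x - a` eliminated as `r`, make the constraint disappear, so Yuan's
  -- lemma applies on a vector space.
  let V := (Fin d ⊕ Fin d → ℝ) × (Fin d → ℝ)
  let p₁ : V →ₗ[ℝ] (Fin d → ℝ) := LinearMap.funLeft ℝ ℝ Sum.inl ∘ₗ LinearMap.fst ℝ _ _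
  let p₂ : V →ₗ[ℝ] (Fin d → ℝ) := LinearMap.funLeft ℝ ℝ Sum.inr ∘ₗ LinearMap.fst ℝ _ _
  let r : V →ₗ[ℝ] (Fin d ⊕ Fin d → ℝ) :=
    (obs d).mulVecLin ∘ₗ LinearMap.snd ℝ _ _ - LinearMap.fst ℝ _ _
  let q₁ := (matrixForm P₁⁻¹).comp p₁
  let q₂ := (matrixForm P₂⁻¹).comp p₂
  let qC := (matrixForm C⁻¹).comp r
  let qB := (matrixForm B⁻¹).comp (LinearMap.snd ℝ (Fin d ⊕ Fin d → ℝ) (Fin d → ℝ))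
  have hq₁ : ∀ v : V, q₁ v = (v.1 ∘ Sum.inl) ⬝ᵥ (P₁⁻¹ *ᵥ (v.1 ∘ Sum.inl)) :=
    fun v => matrixForm_apply P₁⁻¹ (p₁ v)
  have hq₂ : ∀ v : V, q₂ v = (v.1 ∘ Sum.inr) ⬝ᵥ (P₂⁻¹ *ᵥ (v.1 ∘ Sum.inr)) :=
    fun v => matrixForm_apply P₂⁻¹ (p₂ v)
  have hqC : ∀ v : V, qC v = r v ⬝ᵥ (C⁻¹ *ᵥ r v) := fun v => matrixForm_apply C⁻¹ (r v)
  have hqB : ∀ v : V, qB v = v.2 ⬝ᵥ (B⁻¹ *ᵥ v.2) := fun v => matrixForm_apply B⁻¹ v.2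
  have hr : ∀ v : V, v.1 + r v = Sum.elim v.2 v.2 := by
    intro v
    rw [← obs_mulVec]
    exact add_sub_cancel v.1 (obs d *ᵥ v.2)
  have key : ∀ v : V, qB v ≤ max (q₁ v) (q₂ v) + qC v := by
    refine le_of_sublevel_le (fun t v => by rw [QuadraticMap.map_smul, smul_eq_mul]) ?_ ?_ ?_
    · intro t v
      simp only [QuadraticMap.map_smul, smul_eq_mul]
      rw [← mul_max_of_nonneg _ _ (mul_self_nonneg t), mul_add]
    · intro v
      refine add_nonneg (le_max_of_le_left ?_) ?_
      · rw [hq₁]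
        exact inv_form_nonneg h₁ _
      · rw [hqC]
        exact inv_form_nonneg hC _
    · intro v hv
      rw [hq₁, hq₂, hqC] at hv
      rw [hqB]
      exact hB ((mem_minimalVolume_iff h₁ h₂ hC v.2).2 ⟨v.1, r v, hr v, hv⟩)
  obtain ⟨ω, hω, h⟩ := QuadraticMap.exists_mixture_nonneg (q₁ + qC - qB) (q₂ + qC - qB) (by
    intro v
    simp only [_root_.sub_apply, _root_.add_apply]
    rcases max_choice (q₁ v) (q₂ v) with hm | hm
    · left
      have := key v
      rw [hm] at this
      linarith
    · right
      have := key v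
      rw [hm] at this
      linarith)
  refine ⟨ω, hω, fun x hx => ?_⟩
  rw [ellipsoid, Set.mem_ofPred_eq] at hx ⊢
  -- The mixture inequality is used at the optimal split for `x`, where its left part is the inverse
  -- form of the fused bound.
  obtain ⟨a, b, hab, e⟩ := exists_fusedBound_inv_form_eq h₁ h₂ hC hω x
  have hb : r (a, x) = b := add_left_cancel ((hr (a, x)).trans hab.symm)
  have hv := h (a, x)
  simp only [_root_.sub_apply, _root_.add_apply, hq₁, hq₂, hqC, hqB, hb] at hv
  linarith

end Fusion

end ESCI

theorem theorem3 {d : ℕ} (P₁ P₂ : Matrix (Fin d) (Fin d) ℝ)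
    (C : Matrix (Fin d ⊕ Fin d) (Fin d ⊕ Fin d) ℝ)
    (h₁ : P₁.PosDef) (h₂ : P₂.PosDef) (hC : C.PosDef)
    (B : Matrix (Fin d) (Fin d) ℝ)
    (hB : ESCI.TightlyCircumscribes B (ESCI.minimalVolume (ESCI.admissible P₁ P₂ C))) :
    ∃ ω₁ ∈ Set.Icc (0 : ℝ) 1, B = ESCI.fusedBound P₁ P₂ C ω₁ := by
  obtain ⟨ω, hω, h⟩ := ESCI.exists_ellipsoid_fusedBound_subset h₁ h₂ hC hB.subset
  exact ⟨ω, hω, hB.minimal _ (ESCI.posDef_fusedBound h₁ h₂ hC hω)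
    (ESCI.minimalVolume_subset_ellipsoid_fusedBound h₁ h₂ hC hω) h⟩
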